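/- Let $\Sigma$ and $S$ be finite sets, and let $\mathbb N^{\Sigma^*}$ be the space of multisets of strings over $\Sigma$ with finite multiplicities, with the product $\sigma$-algebra and with $\uplus$ (pointwise sum) as union. For a finite set $A\subseteq\Sigma^*$ and $\beta\in\mathbb N^A$ let $[\beta]_A=\{\gamma\in\mathbb N^{\Sigma^*} : \gamma(x)=\beta(x)\text{ for all }x\in A\}$. Strings act on strings by $x\cdot y=xy$, on multisets elementwise, and on measures by pushforward. The finite signed measures $\mathcal S(\mathbb N^{\Sigma^*})$ form a commutative $\mathbb R$-algebra whose multiplication $\mu\mathbin{\&}\nu$ is the pushforward of $\mu\otimes\nu$ under $\uplus$ and whose unit is the point mass at the empty multiset. Let $F=\mathbb R[x\cdot\varepsilon,\ x\cdot s : x\in\Sigma^*, s\in S]$ be the polynomial algebra on formal indeterminates $x\cdot\varepsilon$ and $x\cdot s$; we write $s$ for $1\cdot s$ with $1$ the null string, and $\varepsilon$ for $1\cdot\varepsilon$. Strings act on $F$ by the algebra homomorphisms with $x\cdot(y\cdot\varepsilon)=xy\cdot\varepsilon$ and $x\cdot(y\cdot s)=xy\cdot s$. An automaton is a map $\theta:S\to\mathbb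 R[\varepsilon, a\cdot s : a\in\Sigma,s\in S]\subseteq F$ such that the coefficients of each $\theta(s)$ are non-negative with sum $1$. We also write $\theta:F\to F$ for the algebra homomorphism with $\theta(x\cdot\varepsilon)=x\cdot\varepsilon$ and $\theta(x\cdot s)=x\cdot\theta(s)$. For $f:S\to\mathcal S(\mathbb N^{\Sigma^*})$ let $f^\ddagger:F\to\mathcal S(\mathbb N^{\Sigma^*})$ be the algebra homomorphism with $f^\ddagger(x\cdot s)=x\cdot f(s)$ and $f^\ddagger(x\cdot\varepsilon)$ the point mass at the multiset $\{x\}$. The semantics $[\![-]\!]$ of the automaton is the unique map from $S$ to the probability measures on $\mathbb N^{\Sigma^*}$ with $[\![-]\!]=[\![-]\!]^\ddagger\circ\theta$. A finite tree is a finite set $A\subseteq\Sigma^*$ closed under prefixes; $\partial A$ is the set of prefix-minimal elements of $\Sigma^*\setminus A$. Let $x\cdot\theta:F\to F$ be the algebra homomorphism sending $xz\cdot s$ to $x\cdot\theta(z\cdot s)$ and fixing all other indeterminates. Homomorphisms $\theta_A:\mathbb R[S]\to F$ are defined for finite trees $A$ by letting $\theta_\emptyset$ be the inclusion and $\theta_{A\cup\{x\}}=(x\cdot\theta)\circ\theta_A$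 for $x\in\partial A$ (the result does not depend on the order in which the elements of the tree are added). For $\beta\in\mathbb N^A$ put $m(\beta)=\prod_{y\in A}(y\cdot\varepsilon)^{\beta(y)}$. For $p\in\mathbb R[S]$ and a monomial $m$ in the indeterminates $y\cdot\varepsilon$, let $d_A^m(p)$ be the coefficient of $m$ when $\theta_A(p)$ is read as a polynomial in the indeterminates $y\cdot\varepsilon$ with coefficients that are polynomials in the indeterminates $x\cdot s$; thus $\theta_A(p)=\sum_m d_A^m(p)\cdot m$. Let $\mathbb 1:F\to\mathbb R$ be the algebra homomorphism sending every indeterminate to $1$. Lemma. For every automaton $\theta$, the semantics $[\![-]\!]$ exists and is unique, and for every finite tree $A\subseteq\Sigma^*$, every $\beta\in\mathbb N^A$ and every $s\in S$, $$\mathbb 1\bigl(d_A^{m(\beta)}(s)\bigr)=[\![s]\!]\bigl([\beta]_A\bigr),$$ i.e. this number is the probability that the multiset of accepted strings, sampled from $[\![s]\!]$, agrees with $\beta$ on $A$. -/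

import Mathlib

open MeasureTheory MvPolynomial

noncomputable section

namespace PKA

/-! ## Strings and finite trees -/

/-- A finite tree: a finite set of strings over `α` closed under taking prefixes. -/
def IsTree {α : Type*} (A : Finset (List α)) : Prop :=
  ∀ x ∈ A, ∀ y, y <+: x → y ∈ A

/-- The boundary of `A`: the prefix-minimal elements of the complement of `A`. -/
def boundary {α : Type*} (A : Finset (List α)) : Set (List α) :=
  {x | x ∉ A ∧ ∀ y, y <+: x → y ∉ A → y = x}

/-! ## Multisets of strings -/

/-- Multisets of strings with finite multiplicities. Addition is multiset union, and the
measurable structure (the product one) is the one generated by the sets `cyl A β` below. -/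
abbrev MS (α : Type*) : Type _ := List α → ℕ

open scoped Classical in
/-- The action of strings on multisets of strings: `x · γ` is the multiset of all `xz`, `z ∈ γ`. -/
def shift {α : Type*} (x : List α) (γ : MS α) : MS α :=
  fun y => if x <+: y then γ (y.drop x.length) else 0

open scoped Classical in
/-- The multiset whose only element is the null string, with multiplicity one. -/
def epsMS (α : Type*) : MS α := fun y => if y = [] then 1 else 0

/-- The class of all multisets of strings that agree with `β` on `A`. -/
def cyl {α : Type*} (A : Finset (List α)) (β : A → ℕ) : Set (MS α) :=
  {γ | ∀ x : A, γ x = β x}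

/-! ## The algebra of finite signed measures on multisets of strings -/

/-- Finite signed measures on the space of multisets of strings. -/
abbrev SNS (α : Type*) : Type _ := SignedMeasure (MS α)

namespace SNS

/-- The point mass at a multiset. -/
def dirac {α : Type*} (γ : MS α) : SNS α := VectorMeasure.dirac γ (1 : ℝ)

/-- A probability measure, as an element of the algebra of signed measures. -/
def ofProb {α : Type*} (P : ProbabilityMeasure (MS α)) : SNS α :=
  (P : Measure (MS α)).toSignedMeasure

/-- The action of strings on signed measures: pushforward along `shift x`. -/
def act {α : Type*} (x : List α) (μ : SNS α) : SNS α := VectorMeasure.map μ (shift x)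

instance finVar {X : Type*} [MeasurableSpace X] (μ : SignedMeasure X) :
    IsFiniteMeasure (VectorMeasure.variation μ) := by
  rw [← SignedMeasure.totalVariation_eq_variation]
  unfold SignedMeasure.totalVariation
  infer_instance

/-- The product of two finite signed measures. -/
abbrev tensor {X Y : Type*} [MeasurableSpace X] [MeasurableSpace Y]
    (μ : SignedMeasure X) (ν : SignedMeasure Y) : SignedMeasure (X × Y) :=
  VectorMeasure.prod μ ν (ContinuousLinearMap.mul ℝ ℝ)

/-- Nondeterministic choice: the pushforward of the product measure under multiset union. -/
def amp {α : Type*} (μ ν : SNS α) : SNS α :=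
  VectorMeasure.map (tensor μ ν) (fun p => p.1 + p.2)

theorem tensor_map_left {X X' Y : Type*} [MeasurableSpace X] [MeasurableSpace X']
    [MeasurableSpace Y] (μ : SignedMeasure X) (ν : SignedMeasure Y) {f : X → X'}
    (hf : Measurable f) :
    tensor (VectorMeasure.map μ f) ν = VectorMeasure.map (tensor μ ν) (Prod.map f id) := by
  refine VectorMeasure.prod_eq_of_forall_apply_prod fun s t hs ht => ?_
  rw [VectorMeasure.map_apply _ (hf.prodMap measurable_id) (hs.prod ht),
    VectorMeasure.map_apply _ hf hs]
  have : Prod.map f id ⁻¹' s ×ˢ t = (f ⁻¹' s) ×ˢ t := by ext ⟨a, b⟩; simp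
  rw [this, VectorMeasure.prod_apply]

theorem tensor_comm {X Y : Type*} [MeasurableSpace X] [MeasurableSpace Y]
    (μ : SignedMeasure X) (ν : SignedMeasure Y) :
    tensor μ ν = VectorMeasure.map (tensor ν μ) Prod.swap := by
  refine VectorMeasure.prod_eq_of_forall_apply_prod fun s t hs ht => ?_
  rw [VectorMeasure.map_apply _ measurable_swap (hs.prod ht), Set.preimage_swap_prod,
    VectorMeasure.prod_apply]
  simp [mul_comm]

theorem tensor_assoc {X Y Z : Type*} [MeasurableSpace X] [MeasurableSpace Y] [MeasurableSpace Z]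
    (μ : SignedMeasure X) (ν : SignedMeasure Y) (ρ : SignedMeasure Z) :
    VectorMeasure.map (tensor (tensor μ ν) ρ) MeasurableEquiv.prodAssoc
      = tensor μ (tensor ν ρ) := by
  symm
  refine VectorMeasure.prod_eq_of_forall_apply_prod fun s t hs ht => ?_
  have key : (μ s) • tensor ν ρ = VectorMeasure.map (VectorMeasure.restrict
      (VectorMeasure.map (tensor (tensor μ ν) ρ) MeasurableEquiv.prodAssoc) (s ×ˢ Set.univ))
      Prod.snd := by
    have rect : ∀ (u : Set Y) (v : Set Z), MeasurableSet u → MeasurableSet v →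
        ((μ s) • tensor ν ρ) (u ×ˢ v) = (VectorMeasure.map (VectorMeasure.restrict
          (VectorMeasure.map (tensor (tensor μ ν) ρ) MeasurableEquiv.prodAssoc)
            (s ×ˢ Set.univ)) Prod.snd) (u ×ˢ v) := by
      intro u v hu hv
      rw [VectorMeasure.map_apply _ measurable_snd (hu.prod hv),
        VectorMeasure.restrict_apply _ (hs.prod MeasurableSet.univ)
          (measurable_snd (hu.prod hv)),
        VectorMeasure.map_apply _ MeasurableEquiv.prodAssoc.measurable
          ((measurable_snd (hu.prod hv)).inter (hs.prod MeasurableSet.univ))]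
      have : (MeasurableEquiv.prodAssoc : (X × Y) × Z ≃ᵐ X × Y × Z) ⁻¹'
          (Prod.snd ⁻¹' u ×ˢ v ∩ s ×ˢ Set.univ) = (s ×ˢ u) ×ˢ v := by
        ext ⟨⟨a, b⟩, c⟩
        simp [MeasurableEquiv.prodAssoc]
        tauto
      rw [this, VectorMeasure.prod_apply, VectorMeasure.prod_apply, _root_.smul_apply,
        VectorMeasure.prod_apply]
      simp [mul_assoc]
    refine VectorMeasure.ext_of_generateFrom _ ?_ generateFrom_prod.symm isPiSystem_prod ?_
    · rintro - ⟨u, hu, v, hv, rfl⟩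
      exact rect u v hu hv
    · simpa only [Set.univ_prod_univ] using
        rect _ _ MeasurableSet.univ MeasurableSet.univ
  have h2 := congrArg (fun m : SignedMeasure (Y × Z) => m t) key
  simp only [_root_.smul_apply] at h2
  rw [VectorMeasure.map_apply _ measurable_snd ht,
    VectorMeasure.restrict_apply _ (hs.prod MeasurableSet.univ) (measurable_snd ht)] at h2
  have : Prod.snd ⁻¹' t ∩ s ×ˢ Set.univ = s ×ˢ t := by
    ext ⟨a, b⟩; simp [and_comm]
  rw [this] at h2
  rw [← h2]
  simp

theorem amp_comm {α : Type*} (μ ν : SNS α) : amp μ ν = amp ν μ := by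
  unfold amp
  rw [tensor_comm]
  refine VectorMeasure.ext fun s hs => ?_
  rw [VectorMeasure.map_apply _ (by fun_prop) hs, VectorMeasure.map_apply _ (by fun_prop) hs,
    VectorMeasure.map_apply _ measurable_swap ((by fun_prop : Measurable
      (fun p : MS α × MS α => p.1 + p.2)) hs)]
  congr 1
  ext ⟨a, b⟩
  simp [add_comm]

theorem amp_assoc {α : Type*} (μ ν ρ : SNS α) : amp (amp μ ν) ρ = amp μ (amp ν ρ) := by
  have hadd : Measurable (fun p : MS α × MS α => p.1 + p.2) := by fun_prop
  have e2 : tensor μ (amp ν ρ) = VectorMeasure.map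
      (tensor μ (tensor ν ρ))
      (Prod.map id (fun p : MS α × MS α => p.1 + p.2)) := by
    refine VectorMeasure.prod_eq_of_forall_apply_prod fun s t hs ht => ?_
    unfold amp
    rw [VectorMeasure.map_apply _ (measurable_id.prodMap hadd) (hs.prod ht),
      VectorMeasure.map_apply _ hadd ht]
    have : Prod.map id (fun p : MS α × MS α => p.1 + p.2) ⁻¹' s ×ˢ t
      = s ×ˢ ((fun p : MS α × MS α => p.1 + p.2) ⁻¹' t) := by ext ⟨a, b⟩; simp
    rw [this, VectorMeasure.prod_apply]
  have e1 : tensor (amp μ ν) ρ = _ :=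
    tensor_map_left (tensor μ ν) ρ hadd
  rw [amp, e1, amp, e2, ← tensor_assoc]
  refine VectorMeasure.ext fun s hs => ?_
  rw [VectorMeasure.map_apply _ hadd hs, VectorMeasure.map_apply _ hadd hs,
    VectorMeasure.map_apply _ (hadd.prodMap measurable_id) (hadd hs),
    VectorMeasure.map_apply _ (measurable_id.prodMap hadd) (hadd hs),
    VectorMeasure.map_apply _ MeasurableEquiv.prodAssoc.measurable
      ((measurable_id.prodMap hadd) (hadd hs))]
  congr 1
  ext ⟨⟨a, b⟩, c⟩
  simp [MeasurableEquiv.prodAssoc, add_assoc]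

theorem add_amp {α : Type*} (μ ν ρ : SNS α) : amp (μ + ν) ρ = amp μ ρ + amp ν ρ := by
  have : tensor (μ + ν) ρ
      = tensor μ ρ + tensor ν ρ := by
    refine VectorMeasure.prod_eq_of_forall_apply_prod fun s t hs ht => ?_
    rw [_root_.add_apply, VectorMeasure.prod_apply, VectorMeasure.prod_apply]
    simp
  unfold amp
  rw [this]
  exact VectorMeasure.map_add _ _ _

theorem smul_amp {α : Type*} (r : ℝ) (μ ρ : SNS α) : amp (r • μ) ρ = r • amp μ ρ := by
  have : tensor (r • μ) ρ
      = r • tensor μ ρ := by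
    refine VectorMeasure.prod_eq_of_forall_apply_prod fun s t hs ht => ?_
    rw [_root_.smul_apply, VectorMeasure.prod_apply]
    simp [mul_assoc]
  unfold amp
  rw [this]
  exact VectorMeasure.map_smul _

theorem dirac_zero_amp {α : Type*} (μ : SNS α) : amp (dirac 0) μ = μ := by
  have hadd : Measurable (fun p : MS α × MS α => p.1 + p.2) := by fun_prop
  have hm : Measurable (fun γ : MS α => ((0 : MS α), γ)) := measurable_prodMk_left
  have : tensor (dirac 0) μ
      = VectorMeasure.map (M := ℝ) μ (fun γ => ((0 : MS α), γ)) := by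
    classical
    refine VectorMeasure.prod_eq_of_forall_apply_prod fun s t hs ht => ?_
    rw [VectorMeasure.map_apply _ hm (hs.prod ht), Set.mk_preimage_prod_right_eq_if]
    by_cases h0 : (0 : MS α) ∈ s
    · simp [dirac, h0, hs]
    · simp [dirac, h0]
  rw [amp, this]
  refine VectorMeasure.ext fun s hs => ?_
  rw [VectorMeasure.map_apply _ hadd hs, VectorMeasure.map_apply _ hm (hadd hs)]
  congr 1
  ext γ
  simp

/-- Signed measures form a commutative ring with multiplication `amp` and unit the point mass
at the empty multiset. -/
instance {α : Type*} : CommRing (SNS α) :=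
  { (inferInstance : AddCommGroup (SNS α)) with
    mul := amp
    one := dirac 0
    mul_assoc := amp_assoc
    mul_comm := amp_comm
    one_mul := dirac_zero_amp
    mul_one := fun μ => (amp_comm _ _).trans (dirac_zero_amp μ)
    right_distrib := add_amp
    left_distrib := fun μ ν ρ => by
      change amp μ (ν + ρ) = amp μ ν + amp μ ρ
      rw [amp_comm, add_amp, amp_comm ν, amp_comm ρ]
    zero_mul := fun μ => by
      change amp 0 μ = 0
      have h := smul_amp 0 0 μ
      rwa [zero_smul, zero_smul] at h
    mul_zero := fun μ => by
      change amp μ 0 = 0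
      have h := smul_amp 0 0 μ
      rwa [zero_smul, zero_smul, amp_comm] at h }

instance {α : Type*} : Algebra ℝ (SNS α) :=
  Algebra.ofModule smul_amp (fun r μ ν => by
    change amp μ (r • ν) = r • amp μ ν
    rw [amp_comm, smul_amp, amp_comm])

theorem measurable_shift {α : Type*} (x : List α) : Measurable (shift x) := by
  classical
  refine measurable_pi_lambda _ fun y => ?_
  unfold shift
  split_ifs
  · exact measurable_pi_apply _
  · exact measurable_const

end SNS

/-! ## The free algebra with a string action -/

/-- The polynomial algebra with indeterminates `x · ε` (written `Sum.inl x`) and `x · s`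
(written `Sum.inr (x, s)`), for strings `x` and states `s`. -/
abbrev Free (α S : Type*) : Type _ := MvPolynomial (List α ⊕ List α × S) ℝ

namespace Free

/-- The action of strings on polynomials: `x · (y · ε) = xy · ε` and `x · (y · s) = xy · s`. -/
def act {α S : Type*} (x : List α) : Free α S →ₐ[ℝ] Free α S :=
  rename (Sum.map (fun y => x ++ y) (Prod.map (fun y => x ++ y) id))

/-- The inclusion of polynomials in the states, `s ↦ s`. -/
def incl (α : Type*) {S : Type*} : MvPolynomial S ℝ →ₐ[ℝ] Free α S :=
  rename (fun s => Sum.inr ([], s))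

/-- The unique extension of `f : S → SNS α` to an algebra homomorphism preserving `ε` and the
action of strings. -/
def extendSNS {α S : Type*} (f : S → SNS α) : Free α S →ₐ[ℝ] SNS α :=
  aeval (Sum.elim (fun x => SNS.act x (SNS.dirac (epsMS α))) (fun y => SNS.act y.1 (f y.2)))

/-- The unique extension of `f : S → Free α S` to an algebra homomorphism preserving `ε` and the
action of strings. -/
def extend {α S : Type*} (f : S → Free α S) : Free α S →ₐ[ℝ] Free α S :=
  aeval (Sum.elim (fun x => X (Sum.inl x)) (fun y => act y.1 (f y.2)))

open scoped Classical in
/-- Partial evaluation `x · h`: an indeterminate `xz · s` is sent to `x · h(z · s)`, an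
indeterminate `y · ε` to `h(y · ε)`, and every other indeterminate is left unchanged. -/
def partialEval {α S : Type*} (x : List α) (h : Free α S →ₐ[ℝ] Free α S) :
    Free α S →ₐ[ℝ] Free α S :=
  aeval (Sum.elim (fun y => h (X (Sum.inl y)))
    (fun y => if x <+: y.1 then act x (h (X (Sum.inr (y.1.drop x.length, y.2))))
      else X (Sum.inr y)))

/-- The algebra homomorphism sending every indeterminate to `1`. -/
def bone {α S : Type*} : Free α S →ₐ[ℝ] ℝ := aeval (fun _ => 1)

end Free

/-! ## Automata -/

/-- A probabilistic automaton with states `S` over `α`: every state is assigned a finitely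
supported probability distribution on the monomials in `ε` (written `Sum.inl ()`) and `a · s`
(written `Sum.inr (a, s)`), presented as a polynomial. -/
structure Automaton (α S : Type*) where
  /-- The structure map. -/
  poly : S → MvPolynomial (Unit ⊕ α × S) ℝ
  coeff_nonneg : ∀ s m, 0 ≤ (poly s).coeff m
  sum_coeff : ∀ s, ∑ m ∈ (poly s).support, (poly s).coeff m = 1

namespace Automaton

/-- The structure map, with values in the free algebra. -/
def θ {α S : Type*} (M : Automaton α S) (s : S) : Free α S :=
  rename (Sum.map (fun _ => []) (Prod.map (fun a => [a]) id)) (M.poly s)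

/-- `f` is a fixpoint of the behavioural equation `f = f‡ ∘ θ`. -/
def IsSemantics {α S : Type*} (M : Automaton α S) (f : S → ProbabilityMeasure (MS α)) : Prop :=
  ∀ s, SNS.ofProb (f s) = Free.extendSNS (fun t => SNS.ofProb (f t)) (M.θ s)

open scoped Classical in
/-- The iterated structure map of a finite tree `A`. The empty tree gives the inclusion, and
`thetaTree (A ∪ {x}) = (x · θ) ∘ thetaTree A` for `x` in the boundary of `A`; the last string to
be added is chosen arbitrarily (`thetaTree_insert` below: the order does not matter). -/
def thetaTree {α S : Type*} (M : Automaton α S) (A : Finset (List α)) :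
    MvPolynomial S ℝ →ₐ[ℝ] Free α S :=
  if h : ∃ x, x ∈ A ∧ IsTree (A.erase x) ∧ x ∈ boundary (A.erase x) then
    (Free.partialEval h.choose (Free.extend M.θ)).comp (thetaTree M (A.erase h.choose))
  else Free.incl α
termination_by A.card
decreasing_by exact Finset.card_erase_lt_of_mem h.choose_spec.1

theorem exists_peel {α : Type*} [DecidableEq α] {A : Finset (List α)} (hA : IsTree A)
    (hne : A.Nonempty) :
    ∃ x, x ∈ A ∧ IsTree (A.erase x) ∧ x ∈ boundary (A.erase x) := by
  obtain ⟨x, hx, hmax⟩ := A.exists_max_image List.length hne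
  refine ⟨x, hx, fun z hz y hy => ?_, by simp, fun y hy hyA => ?_⟩
  · rw [Finset.mem_erase] at hz ⊢
    refine ⟨?_, hA z hz.2 y hy⟩
    rintro rfl
    exact hz.1 (hy.eq_of_length (le_antisymm hy.length_le (hmax z hz.2))).symm
  · by_contra hne'
    exact hyA (Finset.mem_erase.2 ⟨hne', hA x hx y hy⟩)

open scoped Classical in
theorem thetaTree_empty {α S : Type*} (M : Automaton α S) : M.thetaTree ∅ = Free.incl α := by
  rw [thetaTree, dif_neg]
  simp

theorem partialEval_act {α S : Type*} (f : S → Free α S) {x y : List α} (h1 : ¬ x <+: y)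
    (h2 : ¬ y <+: x) (p : Free α S) :
    Free.partialEval y (Free.extend f) (Free.act x p) = Free.act x p := by
  have : (Free.partialEval y (Free.extend f)).comp (Free.act x) = Free.act x := by
    refine MvPolynomial.algHom_ext fun i => ?_
    rcases i with z | ⟨z, s⟩
    · simp [Free.partialEval, Free.extend, Free.act]
    · have : ¬ y <+: x ++ z := fun h =>
        (List.prefix_or_prefix_of_prefix h (List.prefix_append x z)).elim h2 h1
      simp [Free.partialEval, Free.act, this]
  exact DFunLike.congr_fun this p

theorem partialEval_comm {α S : Type*} (f : S → Free α S) {x y : List α} (h1 : ¬ x <+: y)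
    (h2 : ¬ y <+: x) :
    (Free.partialEval x (Free.extend f)).comp (Free.partialEval y (Free.extend f)) =
      (Free.partialEval y (Free.extend f)).comp (Free.partialEval x (Free.extend f)) := by
  classical
  refine MvPolynomial.algHom_ext fun i => ?_
  have e : ∀ (u : List α) (z : List α) (s : S),
      Free.partialEval u (Free.extend f) (X (Sum.inr (z, s))) = if u <+: z then
        Free.act u (Free.extend f (X (Sum.inr (z.drop u.length, s)))) else X (Sum.inr (z, s)) := by
    intro u z s
    simp only [Free.partialEval, aeval_X, Sum.elim_inr]
  rcases i with z | ⟨z, s⟩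
  · simp [Free.partialEval, Free.extend]
  · rw [AlgHom.comp_apply, AlgHom.comp_apply, e, e]
    by_cases hx : x <+: z
    · have hy : ¬ y <+: z := fun h => (List.prefix_or_prefix_of_prefix h hx).elim h2 h1
      rw [if_pos hx, if_neg hy, partialEval_act f h1 h2, e, if_pos hx]
    · by_cases hy : y <+: z
      · rw [if_neg hx, if_pos hy, partialEval_act f h2 h1, e, if_pos hy]
      · rw [if_neg hx, if_neg hy, e, e, if_neg hx, if_neg hy]

open scoped Classical in
/-- The recursion that characterizes `thetaTree`, for an arbitrary boundary point `x`. -/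
theorem thetaTree_insert {α S : Type*} (M : Automaton α S) :
    ∀ (A : Finset (List α)), IsTree A → ∀ x ∈ boundary A,
      M.thetaTree (insert x A) =
        (Free.partialEval x (Free.extend M.θ)).comp (M.thetaTree A) := by
  intro A
  induction hn : A.card using Nat.strong_induction_on generalizing A with
  | _ n ih =>
  intro hA x hx
  have hB : IsTree (insert x A) := by
    intro z hz y hy
    rcases Finset.mem_insert.1 hz with rfl | hz
    · by_cases hyA : y ∈ A
      · exact Finset.mem_insert_of_mem hyA
      · exact Finset.mem_insert.2 (Or.inl (hx.2 y hy hyA))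
    · exact Finset.mem_insert_of_mem (hA z hz y hy)
  have hp := exists_peel hB (Finset.insert_nonempty x A)
  rw [thetaTree, dif_pos hp]
  obtain ⟨hy, hyT, hyb⟩ := hp.choose_spec
  generalize hp.choose = y at hy hyT hyb
  by_cases hyx : y = x
  · subst hyx
    rw [Finset.erase_insert hx.1]
  · have hyA : y ∈ A := (Finset.mem_insert.1 hy).resolve_left hyx
    have hxy : ¬ x <+: y := fun h =>
      hx.1 (hA y hyA x h)
    have hyx' : ¬ y <+: x := fun h =>
      (Finset.mem_erase.1 (hyT x (Finset.mem_erase.2 ⟨Ne.symm hyx, Finset.mem_insert_self x A⟩)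
        y h)).1 rfl
    have hAT : IsTree (A.erase y) := by
      intro z hz w hw
      rw [Finset.mem_erase] at hz ⊢
      refine ⟨?_, hA z hz.2 w hw⟩
      rintro rfl
      exact (Finset.mem_erase.1 (hyT z
        (Finset.mem_erase.2 ⟨hz.1, Finset.mem_insert_of_mem hz.2⟩) w hw)).1 rfl
    have hyB : y ∈ boundary (A.erase y) := by
      refine ⟨by simp, fun w hw hwA => ?_⟩
      by_contra hne
      exact hwA (Finset.mem_erase.2 ⟨hne, hA y hyA w hw⟩)
    have hxB : x ∈ boundary (A.erase y) := by
      refine ⟨fun h => hx.1 (Finset.mem_of_mem_erase h), fun w hw hwA => ?_⟩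
      by_cases hwy : w = y
      · exact absurd (hwy ▸ hw) hyx'
      · exact hx.2 w hw fun h => hwA (Finset.mem_erase.2 ⟨hwy, h⟩)
    have hlt : (A.erase y).card < n := hn ▸ Finset.card_erase_lt_of_mem hyA
    have e1 := ih _ hlt (A.erase y) rfl hAT x hxB
    have e2 := ih _ hlt (A.erase y) rfl hAT y hyB
    rw [Finset.insert_erase hyA] at e2
    rw [Finset.erase_insert_of_ne (Ne.symm hyx), e1, e2, ← AlgHom.comp_assoc,
      ← AlgHom.comp_assoc, partialEval_comm M.θ hyx' hxy]

/-- The coefficient of the monomial `m` in the indeterminates `x · ε`, when `thetaTree M A p` is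
read as a polynomial in these indeterminates whose coefficients are polynomials in the
indeterminates `x · s`. -/
def d {α S : Type*} (M : Automaton α S) (A : Finset (List α)) (m : List α →₀ ℕ)
    (p : MvPolynomial S ℝ) : Free α S :=
  rename Sum.inr ((sumAlgEquiv ℝ (List α) (List α × S) (M.thetaTree A p)).coeff m)

/-- The defining decomposition `thetaTree M A p = ∑ m, d M A m p * m`. -/
theorem sum_d {α S : Type*} (M : Automaton α S) (A : Finset (List α)) (p : MvPolynomial S ℝ) :
    M.thetaTree A p = ∑ m ∈ (sumAlgEquiv ℝ (List α) (List α × S) (M.thetaTree A p)).support,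
      M.d A m p * rename Sum.inl (monomial m (1 : ℝ)) := by
  apply (sumAlgEquiv ℝ (List α) (List α × S)).injective
  have h1 (q : MvPolynomial (List α × S) ℝ) :
      sumAlgEquiv ℝ (List α) (List α × S) (rename Sum.inr q) = C q :=
    DFunLike.congr_fun (sumAlgEquiv_comp_rename_inr ℝ _ _) q
  have h2 (q : MvPolynomial (List α) ℝ) :
      sumAlgEquiv ℝ (List α) (List α × S) (rename Sum.inl q) = mapAlgHom (Algebra.ofId _ _) q :=
    DFunLike.congr_fun (sumAlgEquiv_comp_rename_inl ℝ _ _) q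
  rw [map_sum]
  conv_lhs => rw [MvPolynomial.as_sum (sumAlgEquiv ℝ (List α) (List α × S) (M.thetaTree A p))]
  refine Finset.sum_congr rfl fun m _ => ?_
  rw [map_mul, d, h1, h2]
  simp [C_mul_monomial]

end Automaton

/-- The exponents of the monomial `∏_{y ∈ A} (y · ε) ^ β y`. -/
def monom {α : Type*} (A : Finset (List α)) (β : A → ℕ) : List α →₀ ℕ :=
  ∑ y : A, Finsupp.single (y : List α) (β y)

end PKA

end

noncomputable section

namespace PKA

/-! ## The algebra of signed measures: point masses, pushforwards, probabilities -/

namespace SNS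

/-! The semantic equation is contractive: each state in `M.θ s` carries a letter, so the law of
accepted strings of length at most `n` depends only on the successors' laws on strings of length
less than `n` (`res_extendSNS_θ`). Since a signed measure is determined by its restrictions to short
strings (`ext_res_short`), induction on the length bound gives uniqueness. For existence, the
iterates `approx` starting at the unit have compatible restrictions. Their projective limit is built
as a coherent Markov chain of ever finer restrictions (`exists_coherent_measure`,
`exists_limit_of_compatible`), and it solves the equation at every length bound.

For the coefficient formula, unfolding states along a tree `A` does not change the meaning of a
polynomial (`extendSNS_thetaTree`). After unfolding, only emitted strings of `A` and states at
boundary points remain (`thetaTree_mem_supported`). A state at a boundary point can only produce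
strings outside `A`, so on `A` it is indistinguishable from the unit and may be replaced by `1`
(`res_extendSNS_eq_res_emit`). What is left is the finite combination of point masses at the
monomials `m`, with weights `Free.bone (d m)`. Exactly one candidate `m` lies in the cylinder of
`β`, namely `monom A β`. -/

theorem measurable_add (α : Type*) : Measurable (fun p : MS α × MS α => p.1 + p.2) := by
  fun_prop

theorem mul_apply {α : Type*} (μ ν : SNS α) {s : Set (MS α)} (hs : MeasurableSet s) :
    (μ * ν) s = tensor μ ν ((fun p : MS α × MS α => p.1 + p.2) ⁻¹' s) :=
  VectorMeasure.map_apply _ (measurable_add α) hs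

theorem one_def (α : Type*) : (1 : SNS α) = dirac 0 := rfl

theorem ofProb_apply {α : Type*} (P : ProbabilityMeasure (MS α)) {s : Set (MS α)}
    (hs : MeasurableSet s) : ofProb P s = (P : Measure (MS α)).real s :=
  Measure.toSignedMeasure_apply_measurable hs

theorem ofProb_injective {α : Type*} : Function.Injective (ofProb (α := α)) := fun P Q h =>
  Subtype.ext ((Measure.toSignedMeasure_eq_toSignedMeasure_iff
    (μ := (P : Measure (MS α))) (ν := (Q : Measure (MS α)))).1 h)

open scoped Classical in
theorem dirac_apply {α : Type*} (γ : MS α) {s : Set (MS α)} (hs : MeasurableSet s) :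
    dirac γ s = if γ ∈ s then 1 else 0 := by
  split_ifs with h
  · exact VectorMeasure.dirac_apply_of_mem hs h
  · exact VectorMeasure.dirac_apply_of_notMem h

theorem map_dirac {α : Type*} (γ : MS α) {φ : MS α → MS α} (hφ : Measurable φ) :
    VectorMeasure.map (dirac γ) φ = dirac (φ γ) := by
  classical
  refine VectorMeasure.ext fun s hs => ?_
  rw [VectorMeasure.map_apply _ hφ hs, dirac_apply _ (hφ hs), dirac_apply _ hs]
  rfl

theorem ofProb_diracProba {α : Type*} (γ : MS α) : ofProb (diracProba γ) = dirac γ := by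
  classical
  refine VectorMeasure.ext fun s hs => ?_
  rw [ofProb_apply _ hs, dirac_apply _ hs, diracProba, ProbabilityMeasure.coe_mk,
    measureReal_def, Measure.dirac_apply' _ hs]
  by_cases h : γ ∈ s <;> simp [h]

theorem map_ofProb {α : Type*} (P : ProbabilityMeasure (MS α)) {φ : MS α → MS α}
    (hφ : Measurable φ) :
    VectorMeasure.map (ofProb P) φ = ofProb (P.map hφ.aemeasurable) := by
  refine VectorMeasure.ext fun s hs => ?_
  rw [VectorMeasure.map_apply _ hφ hs, ofProb_apply _ hs, ofProb_apply _ (hφ hs),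
    ProbabilityMeasure.toMeasure_map, map_measureReal_apply hφ hs]

theorem ofProb_mul_ofProb {α : Type*} (P Q : ProbabilityMeasure (MS α)) :
    ofProb P * ofProb Q = ofProb ((P.prod Q).map (measurable_add α).aemeasurable) := by
  have key : tensor (ofProb P) (ofProb Q) =
      ((P : Measure (MS α)).prod (Q : Measure (MS α))).toSignedMeasure := by
    refine VectorMeasure.prod_eq_of_forall_apply_prod fun s t hs ht => ?_
    rw [Measure.toSignedMeasure_apply_measurable (hs.prod ht), measureReal_prod_prod,
      ofProb_apply _ hs, ofProb_apply _ ht]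
    simp
  refine VectorMeasure.ext fun s hs => ?_
  rw [mul_apply _ _ hs, key, ofProb_apply _ hs, ProbabilityMeasure.toMeasure_map,
    map_measureReal_apply (measurable_add α) hs,
    Measure.toSignedMeasure_apply_measurable (measurable_add α hs)]
  rfl

/-- The signed measures that are probability measures, as a multiplicative submonoid. -/
def probs (α : Type*) : Submonoid (SNS α) where
  carrier := Set.range ofProb
  one_mem' := ⟨_, ofProb_diracProba 0⟩
  mul_mem' := by
    rintro _ _ ⟨P, rfl⟩ ⟨Q, rfl⟩
    exact ⟨_, (ofProb_mul_ofProb P Q).symm⟩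

theorem ofProb_mem_probs {α : Type*} (P : ProbabilityMeasure (MS α)) : ofProb P ∈ probs α :=
  ⟨P, rfl⟩

theorem dirac_mem_probs {α : Type*} (γ : MS α) : dirac γ ∈ probs α :=
  ⟨_, ofProb_diracProba γ⟩

/-- Both conditions on the right are visibly stable under convex combinations, which is what
`sum_smul_mem_probs` needs. -/
theorem mem_probs_iff {α : Type*} {μ : SNS α} : μ ∈ probs α ↔ 0 ≤ μ ∧ μ Set.univ = 1 := by
  constructor
  · rintro ⟨P, rfl⟩
    refine ⟨fun s hs => ?_, ?_⟩
    · rw [ofProb_apply _ hs]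
      exact measureReal_nonneg
    · rw [ofProb_apply _ MeasurableSet.univ]
      exact probReal_univ
  · rintro ⟨h0, h1⟩
    have h0' : 0 ≤[Set.univ] μ := (VectorMeasure.le_restrict_univ_iff_le 0 μ).2 h0
    have hs (s : Set (MS α)) (hs : MeasurableSet s) :
        (μ.toMeasureOfZeroLE Set.univ .univ h0') s = ENNReal.ofReal (μ s) := by
      rw [SignedMeasure.toMeasureOfZeroLE_apply _ h0' MeasurableSet.univ hs]
      simp only [Set.univ_inter]
      exact (ENNReal.ofReal_eq_coe_nnreal _).symm
    have : IsProbabilityMeasure (μ.toMeasureOfZeroLE Set.univ .univ h0') :=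
      ⟨by rw [hs _ MeasurableSet.univ, h1, ENNReal.ofReal_one]⟩
    let P : ProbabilityMeasure (MS α) := ⟨_, this⟩
    refine ⟨P, VectorMeasure.ext fun s hms => ?_⟩
    rw [ofProb_apply P hms, ProbabilityMeasure.coe_mk, measureReal_def, hs _ hms,
      ENNReal.toReal_ofReal (by simpa using h0 s hms)]

theorem sum_apply {α ι : Type*} (t : Finset ι) (μ : ι → SNS α) (s : Set (MS α)) :
    (∑ i ∈ t, μ i) s = ∑ i ∈ t, μ i s := by
  rw [← FunLike.coeAddMonoidHom_apply, map_sum, Finset.sum_apply]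
  rfl

theorem sum_smul_mem_probs {α ι : Type*} (t : Finset ι) (c : ι → ℝ) (μ : ι → SNS α)
    (h0 : ∀ i ∈ t, 0 ≤ c i) (h1 : ∑ i ∈ t, c i = 1) (hμ : ∀ i ∈ t, μ i ∈ probs α) :
    ∑ i ∈ t, c i • μ i ∈ probs α := by
  have happ (s : Set (MS α)) : (∑ i ∈ t, c i • μ i) s = ∑ i ∈ t, c i * μ i s := by
    rw [sum_apply]
    rfl
  refine mem_probs_iff.2 ⟨fun s hs => ?_, ?_⟩
  · rw [happ]
    exact Finset.sum_nonneg fun i hi =>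
      mul_nonneg (h0 i hi) (by simpa using (mem_probs_iff.1 (hμ i hi)).1 s hs)
  · rw [happ, ← h1]
    exact Finset.sum_congr rfl fun i hi => by rw [(mem_probs_iff.1 (hμ i hi)).2, mul_one]

/-- Pushforward along a measurable additive map is an algebra homomorphism. -/
def push {α : Type*} (φ : MS α →+ MS α) (hφ : Measurable φ) : SNS α →ₐ[ℝ] SNS α :=
  AlgHom.ofLinearMap
    { toFun := fun μ => VectorMeasure.map μ φ
      map_add' := fun μ ν => VectorMeasure.map_add _ _ _
      map_smul' := fun r μ => VectorMeasure.map_smul r }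
    (by
      change VectorMeasure.map (dirac 0) φ = dirac 0
      rw [map_dirac _ hφ, map_zero])
    (by
      intro μ ν
      have hadd := measurable_add α
      have key : tensor (VectorMeasure.map μ φ) (VectorMeasure.map ν φ) =
          VectorMeasure.map (tensor μ ν) (Prod.map φ φ) := by
        refine VectorMeasure.prod_eq_of_forall_apply_prod fun s t hs ht => ?_
        rw [VectorMeasure.map_apply _ (hφ.prodMap hφ) (hs.prod ht),
          VectorMeasure.map_apply _ hφ hs, VectorMeasure.map_apply _ hφ ht,
          ← VectorMeasure.prod_apply (B := ContinuousLinearMap.mul ℝ ℝ)]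
        rfl
      refine VectorMeasure.ext fun s hs => ?_
      change VectorMeasure.map (μ * ν) φ s =
        (VectorMeasure.map μ φ * VectorMeasure.map ν φ : SNS α) s
      rw [VectorMeasure.map_apply _ hφ hs, mul_apply _ _ (hφ hs), mul_apply _ _ hs, key,
        VectorMeasure.map_apply _ (hφ.prodMap hφ) (hadd hs)]
      -- The two preimages coincide because `φ` is additive.
      congr 1
      ext ⟨a, b⟩
      simp)

theorem map_map {α : Type*} (μ : SNS α) {φ ψ : MS α → MS α} (hφ : Measurable φ)
    (hψ : Measurable ψ) :
    VectorMeasure.map (VectorMeasure.map μ φ) ψ = VectorMeasure.map μ (ψ ∘ φ) := by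
  refine VectorMeasure.ext fun s hs => ?_
  rw [VectorMeasure.map_apply _ hψ hs, VectorMeasure.map_apply _ hφ (hψ hs),
    VectorMeasure.map_apply _ (hψ.comp hφ) hs]
  rfl

theorem dirac_add {α : Type*} (γ δ : MS α) : dirac (γ + δ) = (dirac γ * dirac δ : SNS α) := by
  classical
  have key : tensor (dirac γ) (dirac δ) = VectorMeasure.dirac (γ, δ) (1 : ℝ) := by
    refine VectorMeasure.prod_eq_of_forall_apply_prod fun s t hs ht => ?_
    rw [dirac_apply _ hs, dirac_apply _ ht]
    by_cases h1 : γ ∈ s <;> by_cases h2 : δ ∈ t <;>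
      simp [h1, h2, hs.prod ht]
  refine VectorMeasure.ext fun s hs => ?_
  rw [mul_apply _ _ hs, key, dirac_apply _ hs]
  split_ifs with h
  · rw [VectorMeasure.dirac_apply_of_mem (measurable_add α hs) (show (γ, δ) ∈ _ from h)]
  · rw [VectorMeasure.dirac_apply_of_notMem (show (γ, δ) ∉ _ from h)]

/-- Point masses, as a monoid homomorphism. -/
def diracHom (α : Type*) : Multiplicative (MS α) →* SNS α where
  toFun γ := dirac γ.toAdd
  map_one' := rfl
  map_mul' _ _ := dirac_add _ _

end SNS

/-! ## Shifts and restrictions of multisets -/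

theorem shift_nil {α : Type*} (γ : MS α) : shift [] γ = γ := by
  funext y
  simp [shift]

theorem shift_shift {α : Type*} (x y : List α) (γ : MS α) :
    shift x (shift y γ) = shift (x ++ y) γ := by
  classical
  funext z
  unfold shift
  by_cases hx : x <+: z
  · obtain ⟨w, rfl⟩ := hx
    have h1 : (x ++ w).drop x.length = w := List.drop_left
    have h2 : (x ++ w).drop (x ++ y).length = w.drop y.length := by
      rw [List.length_append, ← List.drop_drop, h1]
    rw [h1, h2, if_pos (List.prefix_append x w)]
    exact if_congr (List.prefix_append_right_inj x).symm rfl rfl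
  · have : ¬ x ++ y <+: z := fun h => hx ((List.prefix_append x y).trans h)
    simp [hx, this]

open scoped Classical in
theorem shift_epsMS {α : Type*} (x : List α) : shift x (epsMS α) = Pi.single x 1 := by
  funext y
  by_cases h : x <+: y
  · obtain ⟨w, rfl⟩ := h
    simp [shift, epsMS, Pi.single_apply]
  · have : y ≠ x := fun e => h (e ▸ List.prefix_rfl)
    simp [shift, h, this]

/-- The action of a string on multisets, as an additive map. -/
def shiftHom {α : Type*} (x : List α) : MS α →+ MS α where
  toFun := shift x
  map_zero' := by funext y; simp [shift]
  map_add' γ δ := by funext y; by_cases h : x <+: y <;> simp [shift, h]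

open scoped Classical in
/-- The restriction of a multiset to a set of strings. -/
def restr {α : Type*} (B : Set (List α)) : MS α →+ MS α where
  toFun γ y := if y ∈ B then γ y else 0
  map_zero' := by funext y; simp
  map_add' γ δ := by funext y; by_cases h : y ∈ B <;> simp [h]

open scoped Classical in
theorem restr_apply {α : Type*} (B : Set (List α)) (γ : MS α) (y : List α) :
    restr B γ y = if y ∈ B then γ y else 0 := rfl

theorem measurable_restr {α : Type*} (B : Set (List α)) : Measurable (restr B) := by
  classical
  refine measurable_pi_lambda _ fun y => ?_
  simp only [restr_apply]
  split_ifs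
  · exact measurable_pi_apply _
  · exact measurable_const

theorem restr_restr {α : Type*} (B C : Set (List α)) (γ : MS α) :
    restr B (restr C γ) = restr (B ∩ C) γ := by
  funext y
  by_cases h : y ∈ B <;> by_cases h' : y ∈ C <;> simp [restr_apply, h, h']

theorem restr_shift {α : Type*} (B : Set (List α)) (x : List α) (γ : MS α) :
    restr B (shift x γ) = shift x (restr {y | x ++ y ∈ B} γ) := by
  funext y
  by_cases h : x <+: y
  · obtain ⟨w, rfl⟩ := h
    simp [restr_apply, shift]
  · simp [restr_apply, shift, h]

/-! ### Restriction and string action on signed measures. -/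

namespace SNS

/-- Restriction of signed measures to a set of strings, as an algebra homomorphism. -/
def res {α : Type*} (B : Set (List α)) : SNS α →ₐ[ℝ] SNS α := push (restr B) (measurable_restr B)

theorem res_apply {α : Type*} (B : Set (List α)) (μ : SNS α) :
    res B μ = VectorMeasure.map μ (restr B) := rfl

/-- The action of a string on signed measures, as an algebra homomorphism. -/
def actHom {α : Type*} (x : List α) : SNS α →ₐ[ℝ] SNS α := push (shiftHom x) (measurable_shift x)

theorem actHom_apply {α : Type*} (x : List α) (μ : SNS α) : actHom x μ = act x μ := rfl

theorem act_nil {α : Type*} (μ : SNS α) : act [] μ = μ := by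
  have : shift ([] : List α) = id := funext shift_nil
  rw [act, this, VectorMeasure.map_id]

theorem act_act {α : Type*} (x y : List α) (μ : SNS α) : act x (act y μ) = act (x ++ y) μ := by
  rw [act, act, map_map _ (measurable_shift y) (measurable_shift x)]
  exact congrArg _ (funext (shift_shift x y))

theorem res_act {α : Type*} (B : Set (List α)) (x : List α) (μ : SNS α) :
    res B (act x μ) = act x (res {y | x ++ y ∈ B} μ) := by
  rw [res_apply, act, map_map _ (measurable_shift x) (measurable_restr B), act, res_apply,
    map_map _ (measurable_restr _) (measurable_shift x)]
  exact congrArg _ (funext (restr_shift B x))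

theorem act_dirac {α : Type*} (x : List α) (γ : MS α) : act x (dirac γ) = dirac (shift x γ) :=
  map_dirac γ (measurable_shift x)

theorem act_mem_probs {α : Type*} (x : List α) {μ : SNS α} (hμ : μ ∈ probs α) :
    act x μ ∈ probs α := by
  obtain ⟨P, rfl⟩ := hμ
  exact ⟨_, (map_ofProb P (measurable_shift x)).symm⟩

theorem map_zero_of_mem_probs {α : Type*} {μ : SNS α} (hμ : μ ∈ probs α) :
    VectorMeasure.map μ (fun _ => (0 : MS α)) = 1 := by
  classical
  refine VectorMeasure.ext fun s hs => ?_
  rw [VectorMeasure.map_apply _ measurable_const hs, one_def, dirac_apply _ hs]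
  by_cases h : (0 : MS α) ∈ s
  · simp [h, (mem_probs_iff.1 hμ).2]
  · simp [h]

/-- Every string charged after the action of `x` extends `x` and so misses `B`. All mass, which
totals one, is therefore pushed to the empty multiset. This starts the inductions on length and
later discards the states at the boundary of a tree. -/
theorem res_act_eq_one {α : Type*} {B : Set (List α)} {x : List α} (hB : ∀ y, x ++ y ∉ B)
    {μ : SNS α} (hμ : μ ∈ probs α) : res B (act x μ) = 1 := by
  have h0 : (restr {y | x ++ y ∈ B} : MS α → MS α) = fun _ => 0 := by
    funext γ y
    simp [restr_apply, hB]
  rw [res_act, res_apply, h0, map_zero_of_mem_probs hμ, ← actHom_apply, map_one]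

/-- The set of strings of length less than `n`. -/
def short (α : Type*) (n : ℕ) : Set (List α) := {y | y.length < n}

/-- A signed measure is determined by its restrictions to short strings. -/
theorem ext_res_short {α : Type*} {μ ν : SNS α} (h : ∀ n, res (short α n) μ = res (short α n) ν) :
    μ = ν := by
  -- These cylinders form a π-system, since two of them can be described at the larger of their two
  -- levels. They generate because the multiplicity of `y` is visible at level `y.length + 1`.
  let C : Set (Set (MS α)) :=
    {s | ∃ n, ∃ t, MeasurableSet t ∧ s = restr (short α n) ⁻¹' t}
  have hle {m n : ℕ} (hmn : m ≤ n) (γ : MS α) :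
      restr (short α m) (restr (short α n) γ) = restr (short α m) γ := by
    rw [restr_restr, Set.inter_eq_left.2]
    exact fun y (hy : y.length < m) => lt_of_lt_of_le hy hmn
  have hC : ∀ s ∈ C, μ s = ν s := by
    rintro _ ⟨n, t, ht, rfl⟩
    have := congrArg (fun ρ : SNS α => ρ t) (h n)
    simpa only [res_apply, VectorMeasure.map_apply _ (measurable_restr _) ht] using this
  refine VectorMeasure.ext_of_generateFrom C hC ?_ ?_ ?_
  · refine le_antisymm ?_ ?_
    · refine iSup_le fun y => ?_
      rintro _ ⟨t, ht, rfl⟩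
      refine MeasurableSpace.measurableSet_generateFrom
        ⟨y.length + 1, (fun γ => γ y) ⁻¹' t, measurable_pi_apply y ht, ?_⟩
      ext γ
      simp [restr_apply, short]
    · refine MeasurableSpace.generateFrom_le ?_
      rintro _ ⟨n, t, ht, rfl⟩
      exact measurable_restr _ ht
  · rintro _ ⟨m, s, hs, rfl⟩ _ ⟨n, t, ht, rfl⟩ -
    refine ⟨max m n, _, (measurable_restr (short α m) hs).inter
      (measurable_restr (short α n) ht), ?_⟩
    ext γ
    simp [hle (le_max_left m n), hle (le_max_right m n)]
  · exact hC _ ⟨0, Set.univ, MeasurableSet.univ, rfl⟩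

theorem res_short_zero {α : Type*} {μ : SNS α} (hμ : μ ∈ probs α) : res (short α 0) μ = 1 := by
  have := res_act_eq_one (B := short α 0) (x := []) (by simp [short]) hμ
  rwa [act_nil] at this

end SNS

/-! ## Projective limits of sequences of distributions -/

section ProjectiveLimit

open ProbabilityTheory

/-- For a kernel that depends on the past only through a statistic `f`, this reduces the joint law
of past and next value to that of the statistic and next value. -/
theorem map_prodMap_compProd_comap {X Y Z : Type*} [MeasurableSpace X] [MeasurableSpace Y]
    [MeasurableSpace Z] (ν : Measure X) [SFinite ν] (κ : Kernel Y Z) [IsSFiniteKernel κ]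
    {f : X → Y} (hf : Measurable f) :
    (ν.compProd (κ.comap f hf)).map (Prod.map f id) = (ν.map f).compProd κ := by
  ext s hs
  rw [Measure.map_apply (hf.prodMap measurable_id) hs,
    Measure.compProd_apply (hf.prodMap measurable_id hs), Measure.compProd_apply hs,
    lintegral_map (Kernel.measurable_kernel_prodMk_left hs) hf]
  rfl

/-- A projective sequence of distributions on a standard Borel space, with respect to maps
`ρ n`, is realized by the one-dimensional marginals of a single distribution of sequences that
are almost surely coherent. -/
theorem exists_coherent_measure {X : Type*} [MeasurableSpace X] [StandardBorelSpace X]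
    [Nonempty X] (μ : ℕ → Measure X) [∀ n, IsProbabilityMeasure (μ n)] (ρ : ℕ → X → X)
    (hρ : ∀ n, Measurable (ρ n)) (hμ : ∀ n, (μ (n + 1)).map (ρ n) = μ n) :
    ∃ T : Measure (ℕ → X), IsProbabilityMeasure T ∧ (∀ n, T.map (fun x => x n) = μ n) ∧
      ∀ᵐ x ∂T, ∀ n, ρ n (x (n + 1)) = x n := by
  -- Markov transition: given the last coordinate `y`, the next one is drawn from `μ (n + 1)`
  -- conditioned on its image under `ρ n` being `y`. The standard Borel hypothesis provides this
  -- conditional law.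
  let κ (n : ℕ) : Kernel (Π _ : Finset.Iic n, X) X :=
    (condDistrib id (ρ n) (μ (n + 1))).comap (fun x => x ⟨n, Finset.mem_Iic.2 le_rfl⟩)
      (measurable_pi_apply _)
  let T : Measure (ℕ → X) := Kernel.trajMeasure (X := fun _ => X) (μ 0) κ
  -- The marginal at `n` determines the joint law at `n` and `n + 1`. Its second component is the
  -- next marginal, so `hmarg` follows by induction.
  have hpair (n : ℕ) (hn : T.map (fun x => x n) = μ n) :
      T.map (fun x => (x n, x (n + 1))) = (μ (n + 1)).map (fun x => (ρ n x, x)) := by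
    have h1 := Kernel.map_frestrictLe_trajMeasure_compProd_eq_map_trajMeasure
      (X := fun _ => X) (κ := κ) (μ₀ := μ 0) (a := n)
    have h2 := congrArg (fun m => Measure.map
      (Prod.map (fun x : Π _ : Finset.Iic n, X => x ⟨n, Finset.mem_Iic.2 le_rfl⟩) id) m) h1
    rw [map_prodMap_compProd_comap, Measure.map_map (measurable_pi_apply _) (by fun_prop),
      Measure.map_map (by fun_prop) (by fun_prop)] at h2
    have h3 := compProd_map_condDistrib (X := ρ n) (Y := id) (mβ := ‹_›) (μ := μ (n + 1))
      aemeasurable_id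
    rw [hμ, ← hn] at h3
    exact h2.symm.trans h3
  have hmarg (n : ℕ) : T.map (fun x => x n) = μ n := by
    induction n with
    | zero =>
      have h1 : T.map (Preorder.frestrictLe (π := fun _ : ℕ => X) 0) =
          (μ 0).map (MeasurableEquiv.piUnique (fun _ : Finset.Iic 0 => X)).symm := by
        change (Measure.bind _ _).map _ = _
        rw [Measure.map_comp _ _ (by fun_prop), Kernel.traj_map_frestrictLe,
          Kernel.partialTraj_self, Measure.id_comp]
      have h2 := congrArg (fun m => Measure.map
        (fun x : Π _ : Finset.Iic 0, X => x ⟨0, Finset.mem_Iic.2 le_rfl⟩) m) h1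
      rw [Measure.map_map (measurable_pi_apply _) (by fun_prop),
        Measure.map_map (measurable_pi_apply _) (by fun_prop)] at h2
      exact h2.trans Measure.map_id
    | succ n ih =>
      have h := congrArg (fun m => Measure.map Prod.snd m) (hpair n ih)
      rw [Measure.map_map measurable_snd (by fun_prop),
        Measure.map_map measurable_snd (by fun_prop)] at h
      exact h.trans Measure.map_id
  refine ⟨T, inferInstance, hmarg, ae_all_iff.2 fun n => ?_⟩
  -- Coherence concerns consecutive pairs only, and it holds surely for the pair `(ρ n x, x)`, whose
  -- law is given by `hpair`.
  have hd : MeasurableSet {p : X × X | ρ n p.2 = p.1} :=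
    measurableSet_eq_fun ((hρ n).comp measurable_snd) measurable_fst
  have h : ∀ᵐ p ∂(T.map (fun x => (x n, x (n + 1)))), ρ n p.2 = p.1 := by
    rw [hpair n (hmarg n)]
    exact (ae_map_iff ((hρ n).prodMk measurable_id).aemeasurable hd).2 (by simp)
  exact (ae_map_iff (by fun_prop) hd).1 h

open SNS

/-- Distributions of multisets over longer and longer strings that are compatible with each other
have a limit. -/
theorem exists_limit_of_compatible {α : Type*} [Finite α] (Q : ℕ → ProbabilityMeasure (MS α))
    (hQ : ∀ n, res (short α n) (ofProb (Q (n + 1))) = res (short α n) (ofProb (Q n))) :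
    ∃ P : ProbabilityMeasure (MS α),
      ∀ n, res (short α n) (ofProb P) = res (short α n) (ofProb (Q n)) := by
  let ρ (n : ℕ) : MS α → MS α := restr (short α n)
  have hρ (n : ℕ) : Measurable (ρ n) := measurable_restr _
  -- Compatibility holds only after restriction, so the laws are restricted first to make the
  -- sequence exactly projective.
  let μ (n : ℕ) : Measure (MS α) := (Q n : Measure (MS α)).map (ρ n)
  have hprob (n : ℕ) : IsProbabilityMeasure (μ n) :=
    Measure.isProbabilityMeasure_map (hρ n).aemeasurable
  have hcomp (n : ℕ) (γ : MS α) : ρ n (ρ (n + 1) γ) = ρ n γ := by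
    change restr _ (restr _ γ) = _
    rw [restr_restr, Set.inter_eq_left.2]
    exact fun y (hy : y.length < n) => Nat.lt_succ_of_lt hy
  have hμ (n : ℕ) : (μ (n + 1)).map (ρ n) = μ n := by
    have h := hQ n
    rw [res_apply, res_apply, map_ofProb _ (hρ n), map_ofProb _ (hρ n)] at h
    have h' := congrArg Subtype.val (ofProb_injective h)
    change ((Q (n + 1) : Measure (MS α)).map (ρ (n + 1))).map (ρ n) = _
    rw [Measure.map_map (hρ n) (hρ (n + 1)), show ρ n ∘ ρ (n + 1) = ρ n from funext (hcomp n)]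
    exact h'
  -- Finiteness of the alphabet enters here: there are countably many strings, so the space of
  -- multisets is standard Borel.
  obtain ⟨T, hT, hmarg, hcoh⟩ := exists_coherent_measure μ ρ hρ hμ
  -- The multiplicity of `y` is read at the first level that sees `y`. Along a coherent sequence it
  -- stays constant from there on.
  let Φ : (ℕ → MS α) → MS α := fun x y => x (y.length + 1) y
  have hΦ : Measurable Φ := measurable_pi_lambda _ fun y =>
    (measurable_pi_apply y).comp (measurable_pi_apply (y.length + 1))
  have hρΦ (n : ℕ) : ∀ᵐ x ∂T, ρ n (Φ x) = ρ n (x n) := by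
    filter_upwards [hcoh] with x hx
    have hconst (y : List α) (k : ℕ) : x (y.length + 1 + k) y = x (y.length + 1) y := by
      induction k with
      | zero => rfl
      | succ k ih =>
        rw [← ih, ← hx (y.length + 1 + k)]
        exact (if_pos (show y.length < y.length + 1 + k by omega)).symm
    funext y
    by_cases hy : y ∈ short α n
    · obtain ⟨k, rfl⟩ := Nat.exists_eq_add_of_le (show y.length + 1 ≤ n from hy)
      simp only [ρ, restr_apply, hy, if_true, Φ, hconst]
    · simp only [ρ, restr_apply, hy, if_false]
  let P : ProbabilityMeasure (MS α) :=
    ⟨T.map Φ, Measure.isProbabilityMeasure_map hΦ.aemeasurable⟩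
  refine ⟨P, fun n => ?_⟩
  rw [res_apply, res_apply, map_ofProb P (hρ n), map_ofProb _ (hρ n)]
  refine congrArg ofProb (Subtype.ext ?_)
  change (T.map Φ).map (ρ n) = (Q n : Measure (MS α)).map (ρ n)
  rw [Measure.map_map (hρ n) hΦ,
    Measure.map_congr (show ρ n ∘ Φ =ᵐ[T] ρ n ∘ fun x => x n from hρΦ n),
    ← Measure.map_map (hρ n) (measurable_pi_apply n), hmarg]
  change ((Q n : Measure (MS α)).map (ρ n)).map (ρ n) = _
  rw [Measure.map_map (hρ n) (hρ n)]
  congr 1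
  funext γ
  change restr _ (restr _ γ) = _
  rw [restr_restr, Set.inter_self]

end ProjectiveLimit

open SNS

/-! ## Existence and uniqueness of the semantics -/

namespace Free

theorem extendSNS_X_inl {α S : Type*} (f : S → SNS α) (x : List α) :
    extendSNS f (X (Sum.inl x)) = SNS.act x (dirac (epsMS α)) := by
  simp [extendSNS]

theorem extendSNS_X_inr {α S : Type*} (f : S → SNS α) (x : List α) (s : S) :
    extendSNS f (X (Sum.inr (x, s))) = SNS.act x (f s) := by
  simp [extendSNS]

theorem extendSNS_act {α S : Type*} (f : S → SNS α) (x : List α) (p : Free α S) :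
    extendSNS f (act x p) = SNS.act x (extendSNS f p) := by
  have : (extendSNS f).comp (act x) = (actHom x).comp (extendSNS f) := by
    refine MvPolynomial.algHom_ext fun i => ?_
    rcases i with y | ⟨y, s⟩
    · simp only [AlgHom.comp_apply, act, rename_X, Sum.map_inl, extendSNS_X_inl, actHom_apply,
        act_act]
    · simp only [AlgHom.comp_apply, act, rename_X, Sum.map_inr, Prod.map_apply, id,
        extendSNS_X_inr, actHom_apply, act_act]
  exact DFunLike.congr_fun this p

end Free

namespace Automaton

/-- The values of the indeterminates of an automaton under an assignment of signed measures. -/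
def assign {α S : Type*} (f : S → SNS α) : Unit ⊕ α × S → SNS α :=
  Sum.elim (fun _ => dirac (epsMS α)) (fun y => act [y.1] (f y.2))

theorem extendSNS_θ {α S : Type*} (M : Automaton α S) (f : S → SNS α) (s : S) :
    Free.extendSNS f (M.θ s) = aeval (assign f) (M.poly s) := by
  rw [θ, Free.extendSNS, aeval_rename]
  congr 2
  funext i
  rcases i with u | ⟨a, t⟩
  · simp [assign, act_nil]
  · simp [assign]

/-- Monomials evaluate to products of probability measures, and the coefficients of `M.poly s` form
a convex combination. -/
theorem extendSNS_θ_mem_probs {α S : Type*} (M : Automaton α S) {f : S → SNS α}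
    (hf : ∀ t, f t ∈ probs α) (s : S) : Free.extendSNS f (M.θ s) ∈ probs α := by
  rw [extendSNS_θ, aeval_def, eval₂_eq]
  simp_rw [← Algebra.smul_def]
  refine sum_smul_mem_probs _ _ _ (fun m _ => M.coeff_nonneg s m) (M.sum_coeff s) fun m _ =>
    Submonoid.prod_mem _ fun i _ => Submonoid.pow_mem _ ?_ _
  rcases i with u | ⟨a, t⟩
  · exact dirac_mem_probs _
  · exact act_mem_probs _ (hf t)

/-- This is the contraction. Successor states are prefixed by one letter, and `a :: y` has length
below `n + 1` exactly when `y` has length below `n`. So the two homomorphisms agree on generators.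
-/
theorem res_extendSNS_θ {α S : Type*} (M : Automaton α S) {f g : S → SNS α} {n : ℕ}
    (h : ∀ t, res (short α n) (f t) = res (short α n) (g t)) (s : S) :
    res (short α (n + 1)) (Free.extendSNS f (M.θ s)) =
      res (short α (n + 1)) (Free.extendSNS g (M.θ s)) := by
  have hc : (res (short α (n + 1))).comp (aeval (assign f)) =
      (res (short α (n + 1))).comp (aeval (assign g)) := by
    refine MvPolynomial.algHom_ext fun i => ?_
    rcases i with u | ⟨a, t⟩
    · simp [assign]
    · have hs : {y | a :: y ∈ short α (n + 1)} = short α n := by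
        ext y
        simp [short]
      simp [assign, res_act, hs, h]
  rw [extendSNS_θ, extendSNS_θ]
  exact DFunLike.congr_fun hc _

theorem IsSemantics.unique {α S : Type*} {M : Automaton α S} {f g : S → ProbabilityMeasure (MS α)}
    (hf : M.IsSemantics f) (hg : M.IsSemantics g) : f = g := by
  have h (n : ℕ) : ∀ s, res (short α n) (ofProb (f s)) = res (short α n) (ofProb (g s)) := by
    induction n with
    | zero =>
      intro s
      rw [res_short_zero (ofProb_mem_probs _), res_short_zero (ofProb_mem_probs _)]
    | succ n ih =>
      intro s
      rw [hf s, hg s]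
      exact M.res_extendSNS_θ ih s
  refine funext fun s => ofProb_injective ?_
  exact ext_res_short fun n => h n s

/-- The distributions of the strings accepted within a bounded number of steps. -/
def approx {α S : Type*} (M : Automaton α S) : ℕ → S → SNS α
  | 0, _ => 1
  | n + 1, s => Free.extendSNS (M.approx n) (M.θ s)

theorem approx_mem_probs {α S : Type*} (M : Automaton α S) (n : ℕ) (s : S) :
    M.approx n s ∈ probs α := by
  induction n generalizing s with
  | zero => exact Submonoid.one_mem _
  | succ n ih => exact M.extendSNS_θ_mem_probs ih s

theorem res_approx_succ {α S : Type*} (M : Automaton α S) (n : ℕ) (s : S) :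
    res (short α n) (M.approx (n + 1) s) = res (short α n) (M.approx n s) := by
  induction n generalizing s with
  | zero => rw [res_short_zero (M.approx_mem_probs _ _), res_short_zero (M.approx_mem_probs _ _)]
  | succ n ih => exact M.res_extendSNS_θ ih s

theorem exists_isSemantics {α S : Type*} [Finite α] (M : Automaton α S) :
    ∃ f, M.IsSemantics f := by
  choose Q hQ using M.approx_mem_probs
  have hlim (s : S) := exists_limit_of_compatible (fun n => Q n s) fun n => by
    rw [hQ, hQ, res_approx_succ]
  choose f hf using hlim
  refine ⟨f, fun s => ext_res_short fun n => ?_⟩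
  cases n with
  | zero =>
    rw [res_short_zero (ofProb_mem_probs _),
      res_short_zero (M.extendSNS_θ_mem_probs (fun t => ofProb_mem_probs (f t)) s)]
  | succ n =>
    rw [hf, hQ]
    -- The limit agrees with `approx n` below length `n`, so one transition from it agrees with
    -- `approx (n + 1)` below length `n + 1`.
    exact (M.res_extendSNS_θ (fun t => by rw [hf, hQ]) s).symm

/-! ## Iterated transitions along finite trees -/

/-- Partial evaluation of the structure map does not change the meaning of a polynomial. -/
theorem IsSemantics.extendSNS_partialEval {α S : Type*} {M : Automaton α S}
    {f : S → ProbabilityMeasure (MS α)} (hf : M.IsSemantics f) (x : List α) (p : Free α S) :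
    Free.extendSNS (fun t => ofProb (f t)) (Free.partialEval x (Free.extend M.θ) p) =
      Free.extendSNS (fun t => ofProb (f t)) p := by
  have h : (Free.extendSNS fun t => ofProb (f t)).comp
      (Free.partialEval x (Free.extend M.θ)) = Free.extendSNS fun t => ofProb (f t) := by
    refine MvPolynomial.algHom_ext fun i => ?_
    rcases i with y | ⟨y, s⟩
    · simp [Free.partialEval, Free.extend]
    · by_cases hxy : x <+: y
      · obtain ⟨z, rfl⟩ := hxy
        -- The indeterminate is replaced by `M.θ s` shifted by `x ++ z`, whose value is that of the
        -- original by the fixpoint equation for `s`.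
        simp [Free.partialEval, Free.extend, Free.extendSNS_act, Free.extendSNS_X_inr, ← hf s,
          act_act]
      · simp [Free.partialEval, hxy]
  exact DFunLike.congr_fun h p

theorem tree_induction {α : Type*} [DecidableEq α] {P : Finset (List α) → Prop} (empty : P ∅)
    (insert : ∀ A, IsTree A → ∀ x ∈ boundary A, P A → P (insert x A)) (A : Finset (List α))
    (hA : IsTree A) : P A := by
  induction hn : A.card using Nat.strong_induction_on generalizing A with
  | _ n ih =>
  rcases A.eq_empty_or_nonempty with rfl | hne
  · exact empty
  · obtain ⟨x, hx, hT, hb⟩ := exists_peel hA hne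
    rw [← Finset.insert_erase hx]
    exact insert _ hT x hb (ih _ (hn ▸ Finset.card_erase_lt_of_mem hx) _ hT rfl)

theorem IsSemantics.extendSNS_thetaTree {α S : Type*} {M : Automaton α S}
    {f : S → ProbabilityMeasure (MS α)} (hf : M.IsSemantics f) (A : Finset (List α))
    (hA : IsTree A) (s : S) :
    Free.extendSNS (fun t => ofProb (f t)) (M.thetaTree A (X s)) = ofProb (f s) := by
  classical
  refine tree_induction (P := fun A => Free.extendSNS (fun t => ofProb (f t))
    (M.thetaTree A (X s)) = ofProb (f s)) ?_ (fun A hA x hx ih => ?_) A hA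
  · rw [thetaTree_empty, Free.incl, rename_X, Free.extendSNS_X_inr, act_nil]
  · rw [M.thetaTree_insert A hA x hx, AlgHom.comp_apply, hf.extendSNS_partialEval, ih]

/-- The indeterminates that can occur after the transitions along a finite tree. -/
def frontier {α : Type*} (S : Type*) (A : Finset (List α)) : Set (List α ⊕ List α × S) :=
  {i | Sum.elim (fun y => y ∈ A) (fun y => y.1 ∈ boundary A) i}

theorem X_mem_supported_frontier {α S : Type*} {A : Finset (List α)} {i : List α ⊕ List α × S}
    (hi : i ∈ frontier S A) : (X i : Free α S) ∈ supported ℝ (frontier S A) :=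
  X_mem_supported.2 hi

theorem boundary_insert {α : Type*} [DecidableEq α] {A : Finset (List α)} {x : List α}
    {y : List α} (hy : y ∈ boundary A) (hxy : y ≠ x) :
    y ∈ boundary (insert x A) :=
  ⟨fun h => (Finset.mem_insert.1 h).elim hxy hy.1,
    fun w hw hwA => hy.2 w hw fun h => hwA (Finset.mem_insert_of_mem h)⟩

theorem append_mem_boundary_insert {α : Type*} [DecidableEq α] {A : Finset (List α)}
    (hA : IsTree A) {x : List α} (hx : x ∈ boundary A) (a : α) :
    x ++ [a] ∈ boundary (insert x A) := by
  refine ⟨fun h => ?_, fun w hw hwA => ?_⟩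
  · rcases Finset.mem_insert.1 h with h | h
    · simp at h
    · exact hx.1 (hA _ h _ (List.prefix_append x [a]))
  · rcases List.prefix_concat_iff.1 hw with h | h
    · exact h
    · refine absurd ?_ hwA
      by_cases hw' : w ∈ A
      · exact Finset.mem_insert_of_mem hw'
      · exact Finset.mem_insert.2 (Or.inl (hx.2 w h hw'))

/-- Only states located at `x` itself are rewritten. They yield the emitted string `x`, now in the
tree, and states at the children of `x`, which are now boundary points. -/
theorem partialEval_mem_supported {α S : Type*} [DecidableEq α] (M : Automaton α S)
    {A : Finset (List α)} (hA : IsTree A) {x : List α} (hx : x ∈ boundary A) {p : Free α S}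
    (hp : p ∈ supported ℝ (frontier S A)) :
    Free.partialEval x (Free.extend M.θ) p ∈ supported ℝ (frontier S (insert x A)) := by
  suffices h : supported ℝ (frontier S A) ≤
      (supported ℝ (frontier S (insert x A))).comap
        (Free.partialEval x (Free.extend M.θ)) from h hp
  refine Algebra.adjoin_le ?_
  rintro _ ⟨i, hi, rfl⟩
  change Free.partialEval x (Free.extend M.θ) (X i) ∈ supported ℝ (frontier S (insert x A))
  rcases i with y | ⟨y, s⟩
  · simp only [Free.partialEval, Free.extend, aeval_X, Sum.elim_inl]
    exact X_mem_supported_frontier (Finset.mem_insert_of_mem hi)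
  · replace hi : y ∈ boundary A := hi
    by_cases hyx : y = x
    · subst hyx
      have hθ : Free.partialEval y (Free.extend M.θ) (X (Sum.inr (y, s))) =
          aeval (Sum.elim (fun _ => X (Sum.inl y)) fun u => X (Sum.inr (y ++ [u.1], u.2)))
            (M.poly s) := by
        have h1 : Free.partialEval y (Free.extend M.θ) (X (Sum.inr (y, s))) =
            Free.act y (Free.act [] (M.θ s)) := by
          simp [Free.partialEval, Free.extend]
        rw [h1, θ, Free.act, Free.act, rename_rename, rename_rename, rename_eq_aeval]
        congr 2
        funext i
        rcases i with u | ⟨a, t⟩ <;> simp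
      rw [hθ, aeval_def]
      refine eval₂_mem (fun m _ => Subalgebra.algebraMap_mem _ _) fun i => ?_
      rcases i with u | ⟨a, t⟩
      · exact X_mem_supported_frontier (Finset.mem_insert_self y A)
      · exact X_mem_supported_frontier (append_mem_boundary_insert hA hx a)
    -- Distinct boundary points are prefix-incomparable, by minimality.
    · have : ¬ x <+: y := fun h => hyx (hi.2 x h hx.1).symm
      simp only [Free.partialEval, aeval_X, Sum.elim_inr, this, if_false]
      exact X_mem_supported_frontier (boundary_insert hi hyx)

theorem thetaTree_mem_supported {α S : Type*} (M : Automaton α S) {A : Finset (List α)}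
    (hA : IsTree A) (s : S) : M.thetaTree A (X s) ∈ supported ℝ (frontier S A) := by
  classical
  refine tree_induction (P := fun A => M.thetaTree A (X s) ∈ supported ℝ (frontier S A)) ?_
    (fun A hA x hx ih => ?_) A hA
  · rw [thetaTree_empty, Free.incl, rename_X]
    refine X_mem_supported_frontier ⟨Finset.notMem_empty _, fun y hy _ => ?_⟩
    exact List.prefix_nil.1 hy
  · rw [M.thetaTree_insert A hA x hx, AlgHom.comp_apply]
    exact M.partialEval_mem_supported hA hx ih

/-- Only strings in the tree occur in the emitted part of the result of the transitions along it. -/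
theorem apply_eq_zero_of_mem_support {α S : Type*} {A : Finset (List α)} {p : Free α S}
    (hp : p ∈ supported ℝ (frontier S A)) {m : List α →₀ ℕ}
    (hm : m ∈ (sumAlgEquiv ℝ (List α) (List α × S) p).support) {x : List α} (hx : x ∉ A) :
    m x = 0 := by
  -- The inclusion is checked on generators; state indeterminates become scalars of the coefficient
  -- ring and impose no condition.
  have hle : supported ℝ (frontier S A) ≤
      ((supported (MvPolynomial (List α × S) ℝ) (A : Set (List α))).restrictScalars ℝ).comap
        (sumAlgEquiv ℝ (List α) (List α × S)).toAlgHom := by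
    refine Algebra.adjoin_le ?_
    rintro _ ⟨i, hi, rfl⟩
    change sumAlgEquiv ℝ (List α) (List α × S) (X i) ∈
      supported (MvPolynomial (List α × S) ℝ) (A : Set (List α))
    rcases i with y | y
    · rw [sumAlgEquiv_X_inl]
      exact X_mem_supported.2 hi
    · rw [sumAlgEquiv_X_inr]
      exact Subalgebra.algebraMap_mem _ _
  have h1 : sumAlgEquiv ℝ (List α) (List α × S) p ∈
      supported (MvPolynomial (List α × S) ℝ) (A : Set (List α)) := hle hp
  by_contra h0
  exact hx (mem_supported.1 h1 ((mem_vars_iff_mem_support x).2 ⟨m, hm, Finsupp.mem_support_iff.2 h0⟩))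

open scoped Classical in
/-- The evaluation that remembers the emitted strings and forgets the states. -/
def emit (α S : Type*) : Free α S →ₐ[ℝ] SNS α :=
  aeval (Sum.elim (fun x => dirac (Pi.single x 1)) (fun _ => 1))

theorem emit_rename_inr {α S : Type*} (q : MvPolynomial (List α × S) ℝ) :
    emit α S (rename Sum.inr q) = algebraMap ℝ (SNS α) (Free.bone (rename Sum.inr q : Free α S)) := by
  have h : (emit α S).comp (rename Sum.inr) =
      (Algebra.ofId ℝ (SNS α)).comp (Free.bone.comp (rename (Sum.inr (α := List α)))) := by
    refine MvPolynomial.algHom_ext fun i => ?_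
    simp [emit, Free.bone]
  exact DFunLike.congr_fun h q

/-- A multiset is the sum of its singletons, and `diracHom` turns sums of multisets into products of
point masses. -/
theorem emit_monomial {α : Type*} (S : Type*) (m : List α →₀ ℕ) :
    emit α S (rename Sum.inl (monomial m (1 : ℝ))) = dirac m := by
  classical
  have h : (m : MS α) = ∑ x ∈ m.support, m x • Pi.single x 1 := by
    funext y
    simp [Finset.sum_apply, Pi.single_apply]
  rw [emit, aeval_rename, aeval_monomial, map_one, one_mul]
  conv_rhs => rw [h]
  change _ = diracHom α (Multiplicative.ofAdd (∑ x ∈ m.support, m x • Pi.single x 1))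
  rw [ofAdd_sum, map_prod]
  refine Finset.prod_congr rfl fun x _ => ?_
  rw [ofAdd_nsmul, map_pow]
  rfl

/-- Both sides are homomorphisms, so generators suffice. Emitted strings have equal values. A state
at a boundary point `y` produces only extensions of `y`, none of which lies in the prefix-closed set
`A`, so its restriction is `1`. -/
theorem res_extendSNS_eq_res_emit {α S : Type*} {f : S → SNS α} (hf : ∀ t, f t ∈ probs α)
    {A : Finset (List α)} (hA : IsTree A) {p : Free α S} (hp : p ∈ supported ℝ (frontier S A)) :
    res A (Free.extendSNS f p) = res A (emit α S p) := by
  suffices h : supported ℝ (frontier S A) ≤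
      AlgHom.equalizer ((res (A : Set (List α))).comp (Free.extendSNS f))
        ((res (A : Set (List α))).comp (emit α S)) from h hp
  refine Algebra.adjoin_le ?_
  rintro _ ⟨i, hi, rfl⟩
  change res (A : Set (List α)) (Free.extendSNS f (X i)) = res (A : Set (List α)) (emit α S (X i))
  rcases i with y | ⟨y, s⟩
  · rw [Free.extendSNS_X_inl, act_dirac, shift_epsMS]
    simp [emit]
  · replace hi : y ∈ boundary A := hi
    rw [Free.extendSNS_X_inr, res_act_eq_one _ (hf s)]
    · simp [emit]
    · exact fun z hz => hi.1 (hA _ hz y (List.prefix_append y z))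

end Automaton

/-! ### Cylinder sets and the coefficient formula. -/

theorem measurableSet_cyl {α : Type*} (A : Finset (List α)) (β : A → ℕ) :
    MeasurableSet (cyl A β) := by
  have : cyl A β = ⋂ x : A, (fun γ : MS α => γ x) ⁻¹' {β x} := by
    ext γ
    simp [cyl]
  rw [this]
  exact MeasurableSet.iInter fun x => measurable_pi_apply _ (measurableSet_singleton _)

theorem monom_apply {α : Type*} (A : Finset (List α)) (β : A → ℕ) (x : A) : monom A β x = β x := by
  classical
  simp [monom, Finsupp.finsetSum_apply, Finsupp.single_apply]

theorem monom_apply_of_notMem {α : Type*} {A : Finset (List α)} (β : A → ℕ) {x : List α}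
    (hx : x ∉ A) : monom A β x = 0 := by
  classical
  rw [monom, Finsupp.finsetSum_apply]
  refine Finset.sum_eq_zero fun y _ => Finsupp.single_eq_of_ne ?_
  rintro rfl
  exact hx y.2

theorem coe_mem_cyl_iff {α : Type*} {A : Finset (List α)} (β : A → ℕ) {m : List α →₀ ℕ}
    (hm : ∀ x ∉ A, m x = 0) : (m : MS α) ∈ cyl A β ↔ m = monom A β := by
  constructor
  · intro h
    ext x
    by_cases hx : x ∈ A
    · exact (h ⟨x, hx⟩).trans (monom_apply A β ⟨x, hx⟩).symm
    · rw [hm x hx, monom_apply_of_notMem β hx]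
  · rintro rfl x
    exact monom_apply A β x

theorem SNS.res_apply_cyl {α : Type*} (A : Finset (List α)) (β : A → ℕ) (μ : SNS α) :
    res A μ (cyl A β) = μ (cyl A β) := by
  rw [res_apply, VectorMeasure.map_apply _ (measurable_restr _) (measurableSet_cyl A β)]
  congr 1
  ext γ
  exact forall_congr' fun x => by rw [restr_apply, if_pos (Finset.mem_coe.2 x.2)]

theorem Automaton.bone_d_monom {α S : Type*} {M : Automaton α S}
    {f : S → ProbabilityMeasure (MS α)} (hf : M.IsSemantics f) {A : Finset (List α)}
    (hA : IsTree A) (β : A → ℕ) (s : S) :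
    Free.bone (M.d A (monom A β) (X s)) = (f s : Measure (MS α)).real (cyl A β) := by
  classical
  have hsupp := M.thetaTree_mem_supported hA s
  rw [← ofProb_apply _ (measurableSet_cyl A β), ← SNS.res_apply_cyl,
    ← hf.extendSNS_thetaTree A hA s,
    res_extendSNS_eq_res_emit (fun t => ofProb_mem_probs (f t)) hA hsupp, SNS.res_apply_cyl,
    M.sum_d, map_sum, SNS.sum_apply]
  -- Each term is a scalar times a point mass at `m`. As `m` vanishes off `A`, the cylinder contains
  -- it only when `m = monom A β`.
  have hterm : ∀ m ∈ (sumAlgEquiv ℝ (List α) (List α × S) (M.thetaTree A (X s))).support,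
      emit α S (M.d A m (X s) * rename Sum.inl (monomial m (1 : ℝ))) (cyl A β)
        = if m = monom A β then Free.bone (M.d A m (X s)) else 0 := by
    intro m hm
    rw [map_mul, emit_monomial, d, emit_rename_inr, ← Algebra.smul_def]
    change Free.bone (M.d A m (X s)) * dirac (m : MS α) (cyl A β) = _
    rw [dirac_apply _ (measurableSet_cyl A β), mul_ite, mul_one, mul_zero]
    exact if_congr (coe_mem_cyl_iff β fun x hx => apply_eq_zero_of_mem_support hsupp hm hx) rfl rfl
  rw [Finset.sum_congr rfl hterm, Finset.sum_ite_eq']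
  split_ifs with h
  · rfl
  -- If the monomial does not occur, its coefficient is zero, matching the empty sum.
  · rw [d, notMem_support_iff.1 h, map_zero, map_zero]

end PKA

end

theorem mainTheorem5 {α S : Type*} [Finite α] [Finite S] (M : PKA.Automaton α S) :
    (∃! sem : S → ProbabilityMeasure (PKA.MS α), M.IsSemantics sem) ∧
    ∀ sem : S → ProbabilityMeasure (PKA.MS α), M.IsSemantics sem →
      ∀ A : Finset (List α), PKA.IsTree A → ∀ (β : A → ℕ) (s : S),
        PKA.Free.bone (M.d A (PKA.monom A β) (X s)) =
          ((sem s : Measure (PKA.MS α)).real (PKA.cyl A β)) := by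
  obtain ⟨f, hf⟩ := M.exists_isSemantics
  exact ⟨⟨f, hf, fun g hg => hg.unique hf⟩,
    fun sem hsem A hA β s => PKA.Automaton.bone_d_monom hsem hA β s⟩
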